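/- Let $\mathbb{E}_1,\mathbb{E}_2$ be Euclidean spaces (finite-dimensional real inner product spaces). Attach a formal largest element $+\infty_\bullet$ to $\mathbb{E}_2$, let $F\colon\mathbb{E}_1\to\mathbb{E}_2\cup\{+\infty_\bullet\}$, and write $\mathrm{dom}\,F=\{x: F(x)\in\mathbb{E}_2\}$, $\mathrm{gph}\,F=\{(x,F(x)):x\in\mathrm{dom}\,F\}$ and $\mathrm{rge}\,F=\{F(x):x\in\mathrm{dom}\,F\}$. For a closed convex cone $K\subset\mathbb{E}_2$ (with $0\in K$) put $$\mathrm{Epi}_K F=\{(x,y)\in\mathrm{dom}\,F\times\mathbb{E}_2 : y-F(x)\in K\},\qquad -K^\circ=\{v\in\mathbb{E}_2:\langle u,v\rangle\ge 0\ \ \forall u\in K\}.$$ $F$ is called proper if $\mathrm{dom}\,F\neq\emptyset$, $K$-closed if $\mathrm{Epi}_K F$ is closed, and $K$-convex if $\mathrm{Epi}_K F$ is convex. For $u\in\mathbb{E}_2$, let $\langle u,F\rangle\colon\mathbb{E}_1\to\mathbb{R}\cup\{+\infty\}$ be equal to $\langle u,F(x)\rangle$ for $x\in\mathrm{dom}\,F$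 and to $+\infty$ otherwise; for $C\subset\mathbb{E}_1$ let $\delta_C$ be $0$ on $C$ and $+\infty$ elsewhere. Let $K\subset\mathbb{E}_2$ be a closed convex cone with $K\subset -K^\circ$, and let $F$ be proper, $K$-closed and $K$-convex. Assume: (i) there is a nonempty set $L\subset K\cap\mathrm{rge}\,F$ such that the closure of the convex conical hull of $L$ is $K$; (ii) for every $u\in L$ there is a convex set $C^u\subset\mathrm{dom}\,F$ with $F(C^u)\subset\mathbb{R}_+u$; (iii) for every $u\in L$ the function $f_u:=\langle u,F\rangle+\delta_{C^u}$ is proper (i.e. finite somewhere) and convex, its epigraph $\{(x,\alpha)\in\mathbb{E}_1\times\mathbb{R}: f_u(x)\le\alpha\}$ is closed in the subspace topology of $C^u\times\mathbb{R}$, and there is no affine function $\varphi\colon\mathbb{E}_1\to\mathbb{R}$ with $f_u(x)\le\varphi(x)$ for all $x\in\mathrm{dom}\,f_u=\{x: f_u(x)<+\infty\}$. Then $\mathrm{Epi}_K F=\overline{\mathrm{conv}}\,(\mathrm{gph}\,F)$, the closed convex hull of the graph of $F$. Moreover, $K=\hat K_F$, where $\hat K_F$ denotes the smallest closed convex cone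 $\hat K\subset\mathbb{E}_2$ such that $F$ is $\hat K$-closed and $\hat K$-convex (in particular, $\hat K_F$ exists). -/

import Mathlib

open scoped Pointwise InnerProductSpace

/-! Extended-valued maps are total maps into `WithTop`: a map `F : E₁ → E₂ ∪ {+∞}` (with a formal
largest element attached to `E₂`) is a term `F : E₁ → WithTop E₂`, and a function
`f : E → ℝ ∪ {+∞}` is a term `f : E → WithTop ℝ`. -/

namespace ConeMap

section Maps

variable {X Y : Type*}

/-- The domain of an extended-valued map: the points where the value is not `+∞`. -/
def dom (F : X → WithTop Y) : Set X := {x | F x ≠ ⊤}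

/-- A map is proper if its domain is nonempty (the value `-∞` is excluded by the type). -/
def IsProper (F : X → WithTop Y) : Prop := (dom F).Nonempty

/-- The graph `{(x, F x) | x ∈ dom F}`, a subset of `X × Y`. -/
def graph (F : X → WithTop Y) : Set (X × Y) := {p | F p.1 = (p.2 : WithTop Y)}

/-- The range `{F x | x ∈ dom F}`, a subset of `Y`. -/
def range (F : X → WithTop Y) : Set Y := {y | ∃ x, F x = (y : WithTop Y)}

end Maps

section Scalar

variable {E : Type*} [NormedAddCommGroup E] [InnerProductSpace ℝ E]

/-- The epigraph of a function `f : E → ℝ ∪ {+∞}`. -/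
def epi (f : E → WithTop ℝ) : Set (E × ℝ) := {p | f p.1 ≤ (p.2 : WithTop ℝ)}

/-- `f` is `D`-closed: the epigraph of `f` is closed in the subspace topology of `D × ℝ`. -/
def IsClosedOn (D : Set E) (f : E → WithTop ℝ) : Prop :=
  IsClosed {p : ((D ×ˢ Set.univ : Set (E × ℝ)) : Type _) | (p : E × ℝ) ∈ epi f}

/-- The class `Γ₀(D)`: proper convex functions `f : E → ℝ ∪ {+∞}` that are `D`-closed. -/
def GammaZero (D : Set E) : Set (E → WithTop ℝ) :=
  {f | IsProper f ∧ Convex ℝ (epi f) ∧ IsClosedOn D f}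

/-- `f` is majorized on its domain by some affine function `E → ℝ`. -/
def HasAffineMajorant (f : E → WithTop ℝ) : Prop :=
  ∃ φ : E →ᵃ[ℝ] ℝ, ∀ x ∈ dom f, f x ≤ (φ x : WithTop ℝ)

open Classical in
/-- The indicator function `δ_S`: zero on `S` and `+∞` outside. -/
noncomputable def indicator (S : Set E) : E → WithTop ℝ := fun x => if x ∈ S then 0 else ⊤

end Scalar

section Cone

variable {E₁ E₂ : Type*} [NormedAddCommGroup E₁] [InnerProductSpace ℝ E₁]
  [NormedAddCommGroup E₂] [InnerProductSpace ℝ E₂]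

/-- The scalarization `⟨u, F⟩`: it is `⟪u, F x⟫` on `dom F` and `+∞` elsewhere. -/
noncomputable def scalarization (u : E₂) (F : E₁ → WithTop E₂) : E₁ → WithTop ℝ :=
  fun x => (F x).map (fun y => ⟪u, y⟫_ℝ)

/-- The `K`-epigraph `{(x, y) | x ∈ dom F, y - F x ∈ K}`. -/
def kEpi (K : Set E₂) (F : E₁ → WithTop E₂) : Set (E₁ × E₂) :=
  {p | ∃ z : E₂, F p.1 = (z : WithTop E₂) ∧ p.2 - z ∈ K}

/-- `F` is `K`-convex: its `K`-epigraph is convex. -/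
def KConvex (K : Set E₂) (F : E₁ → WithTop E₂) : Prop := Convex ℝ (kEpi K F)

/-- `F` is `K`-closed: its `K`-epigraph is closed. -/
def KClosed (K : Set E₂) (F : E₁ → WithTop E₂) : Prop := IsClosed (kEpi K F)

/-- `K` is the smallest closed convex cone with respect to which `F` is both closed and convex.
A `ProperCone` is a closed convex cone containing `0`; it may be `{0}`, the whole space, or contain
lines. -/
def IsSmallestCone (F : E₁ → WithTop E₂) (K : ProperCone ℝ E₂) : Prop :=
  KClosed (K : Set E₂) F ∧ KConvex (K : Set E₂) F ∧
    ∀ K' : ProperCone ℝ E₂, KClosed (K' : Set E₂) F → KConvex (K' : Set E₂) F →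
      (K : Set E₂) ⊆ (K' : Set E₂)

end Cone

end ConeMap

namespace ConeMap

section Maps

variable {X Y : Type*}

/-! The `K`-epigraph is closed, convex and contains the graph, hence contains its closed convex
hull. If some point `(x, F x + k)` with `k ∈ K` lay outside the hull, a functional `g` would
separate it strictly from the graph. Being bounded above on the graph, `g` cannot increase in a
direction `u ∈ L`, since otherwise its bound would give an affine majorant of `⟨u, F⟩` on `C`. So `g
(0, ·) ≤ 0` on `K`, contradicting separation. Minimality follows because the hull does not depend on
the cone. -/

theorem mem_dom_iff {F : X → WithTop Y} {x : X} : x ∈ dom F ↔ ∃ y : Y, F x = (y : WithTop Y) := by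
  simp [dom, WithTop.ne_top_iff_exists, eq_comm]

end Maps

section Cone

variable {E₁ E₂ : Type*} [NormedAddCommGroup E₁] [InnerProductSpace ℝ E₁]
  [NormedAddCommGroup E₂] [InnerProductSpace ℝ E₂]

theorem graph_subset_kEpi
    (K : ProperCone ℝ E₂) (F : E₁ → WithTop E₂) :
    graph F ⊆ kEpi (K : Set E₂) F := by
  rintro ⟨x, y⟩ h
  exact ⟨y, h, by simp⟩

theorem closedConvexHull_graph_subset_kEpi {K : ProperCone ℝ E₂} {F : E₁ → WithTop E₂}
    (hclosed : KClosed (K : Set E₂) F) (hconvex : KConvex (K : Set E₂) F) :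
    closedConvexHull ℝ (graph F) ⊆ kEpi (K : Set E₂) F :=
  closedConvexHull_min (graph_subset_kEpi K F) hconvex hclosed

/-- A continuous linear functional that is bounded above on the graph of `F` is nonpositive in
every direction `u` along which `F` has no affine majorant. -/
theorem apply_le_zero_of_not_hasAffineMajorant {F : E₁ → WithTop E₂} {u : E₂} {C : Set E₁}
    (hC : ∀ x ∈ C, ∃ t : ℝ, 0 ≤ t ∧ F x = ((t • u : E₂) : WithTop E₂))
    (hmaj : ¬ HasAffineMajorant (scalarization u F + indicator C))
    (g : StrongDual ℝ (E₁ × E₂)) (c : ℝ) (hg : ∀ p ∈ graph F, g p ≤ c) : g (0, u) ≤ 0 := by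
  by_contra! hpos
  -- On `C`, `F x = t • u`, so `g ≤ c` bounds `t` by `(c - g (x, 0)) / g (0, u)`, which is affine in
  -- `x`. The scalarization there is `t * ⟪u, u⟫`, whence the factor.
  refine hmaj ⟨(⟪u, u⟫_ℝ / g (0, u)) • (AffineMap.const ℝ E₁ c -
    (g.toLinearMap ∘ₗ LinearMap.inl ℝ E₁ E₂).toAffineMap), fun x hx => ?_⟩
  have hxC : x ∈ C := by
    by_contra h
    simp [dom, indicator, h] at hx
  obtain ⟨t, -, ht⟩ := hC x hxC
  have hsplit : g (x, t • u) = g (x, 0) + t * g (0, u) := by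
    rw [← smul_eq_mul, ← map_smul, ← map_add]
    simp
  have hle : t * g (0, u) ≤ c - g (x, 0) := by linarith [hg (x, t • u) ht]
  have key : t * ⟪u, u⟫_ℝ ≤ ⟪u, u⟫_ℝ / g (0, u) * (c - g (x, 0)) := by
    rw [div_mul_eq_mul_div, le_div_iff₀ hpos]
    nlinarith [mul_le_mul_of_nonneg_left hle (real_inner_self_nonneg (x := u))]
  simpa [scalarization, indicator, hxC, ht, inner_smul_right] using WithTop.coe_le_coe.2 key

/-- A continuous linear functional that is nonpositive on `L` is nonpositive on the closed convex
cone generated by `L`. -/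
theorem apply_le_zero_of_mem_closure_hull {L : Set E₂} (g : StrongDual ℝ E₂)
    (hg : ∀ u ∈ L, g u ≤ 0) {k : E₂} (hk : k ∈ closure (PointedCone.hull ℝ L : Set E₂)) :
    g k ≤ 0 := by
  refine closure_minimal (t := {y | g y ≤ 0}) (fun y hy => ?_)
    (isClosed_le g.continuous continuous_const) hk
  induction hy using Submodule.span_induction with
  | mem y hy => exact hg y hy
  | zero => simp
  | add y z _ _ hy hz =>
    simp only [Set.mem_ofPred_eq, map_add] at *
    linarith
  | smul a y _ hy =>
    have : g (a • y) = (a : ℝ) * g y := by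
      rw [← smul_eq_mul, ← map_smul]
      rfl
    simpa only [Set.mem_ofPred_eq, this] using mul_nonpos_of_nonneg_of_nonpos a.2 hy

/-- If `F` is proper and its `K`-epigraph is the closed convex hull of its graph, then `K` is
contained in every closed convex cone with respect to which `F` is closed and convex. -/
theorem subset_of_kEpi_eq_closedConvexHull {K K' : ProperCone ℝ E₂} {F : E₁ → WithTop E₂}
    (hproper : IsProper F) (hK : kEpi (K : Set E₂) F = closedConvexHull ℝ (graph F))
    (hclosed : KClosed (K' : Set E₂) F) (hconvex : KConvex (K' : Set E₂) F) :
    (K : Set E₂) ⊆ (K' : Set E₂) := by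
  intro k hk
  -- One domain point suffices: the fibre of the `K`-epigraph over it is `F x + K`, so the cones can
  -- be compared there.
  obtain ⟨x, hx⟩ := hproper
  obtain ⟨z, hz⟩ := mem_dom_iff.1 hx
  have hmem : (x, z + k) ∈ kEpi (K : Set E₂) F := ⟨z, hz, by simpa using hk⟩
  rw [hK] at hmem
  obtain ⟨z', hz', hk'⟩ := closedConvexHull_graph_subset_kEpi hclosed hconvex hmem
  obtain rfl : z = z' := WithTop.coe_injective (hz.symm.trans hz')
  simpa using hk'

end Cone

end ConeMap

/-- Here `ProperCone.innerDual K = {v | ∀ u ∈ K, 0 ≤ ⟪u, v⟫}` is the dual cone `-K°`, and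
`PointedCone.hull ℝ L` is the convex conical hull of `L`. -/
theorem lemmal {E₁ E₂ : Type*}
    [NormedAddCommGroup E₁] [InnerProductSpace ℝ E₁] [FiniteDimensional ℝ E₁]
    [NormedAddCommGroup E₂] [InnerProductSpace ℝ E₂] [FiniteDimensional ℝ E₂]
    (K : ProperCone ℝ E₂)
    (hKdual : (K : Set E₂) ⊆ (ProperCone.innerDual (K : Set E₂) : Set E₂))
    (F : E₁ → WithTop E₂)
    (hproper : ConeMap.IsProper F)
    (hclosed : ConeMap.KClosed (K : Set E₂) F)
    (hconvex : ConeMap.KConvex (K : Set E₂) F)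
    (L : Set E₂)
    (hLne : L.Nonempty)
    (hLsub : L ⊆ (K : Set E₂) ∩ ConeMap.range F)
    (hLcone : closure (PointedCone.hull ℝ L : Set E₂) = (K : Set E₂))
    (hL : ∀ u ∈ L, ∃ C : Set E₁, Convex ℝ C ∧ C ⊆ ConeMap.dom F ∧
      (∀ x ∈ C, ∃ t : ℝ, 0 ≤ t ∧ F x = ((t • u : E₂) : WithTop E₂)) ∧
      ConeMap.scalarization u F + ConeMap.indicator C ∈ ConeMap.GammaZero C ∧
      ¬ ConeMap.HasAffineMajorant (ConeMap.scalarization u F + ConeMap.indicator C)) :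
    ConeMap.kEpi (K : Set E₂) F = closedConvexHull ℝ (ConeMap.graph F) ∧
      ConeMap.IsSmallestCone F K := by
  have heq : ConeMap.kEpi (K : Set E₂) F = closedConvexHull ℝ (ConeMap.graph F) := by
    refine Set.Subset.antisymm ?_ (ConeMap.closedConvexHull_graph_subset_kEpi hclosed hconvex)
    rintro ⟨x, y⟩ ⟨z, hz, hk⟩
    by_contra hnot
    obtain ⟨g, c, hgc, hc⟩ := geometric_hahn_banach_closed_point
      (convex_closedConvexHull (𝕜 := ℝ) (s := ConeMap.graph F)) isClosed_closedConvexHull hnot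
    have hgraph : ∀ p ∈ ConeMap.graph F, g p < c :=
      fun p hp => hgc p (subset_closedConvexHull hp)
    -- Passing from the graph point `(x, z)` to `(x, y)` does not increase `g`, so `g (x, y) < c` as
    -- well.
    have hle : g (0, y - z) ≤ 0 := by
      refine ConeMap.apply_le_zero_of_mem_closure_hull (g ∘L ContinuousLinearMap.inr ℝ E₁ E₂)
        (fun u hu => ?_) (hLcone ▸ hk)
      obtain ⟨C, -, -, hC, -, hmaj⟩ := hL u hu
      exact ConeMap.apply_le_zero_of_not_hasAffineMajorant hC hmaj g c fun p hp => (hgraph p hp).le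
    have hsplit : g (x, y) = g (x, z) + g (0, y - z) := by
      rw [← map_add]
      simp
    linarith [hgraph (x, z) hz]
  exact ⟨heq, hclosed, hconvex, fun _ hcl hcv =>
    ConeMap.subset_of_kEpi_eq_closedConvexHull hproper heq hcl hcv⟩
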